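/- Let $M$ be a von Neumann algebra and let $\alpha:M\to M$ be a normal unital $*$-endomorphism, with tail algebra $M_\infty=\bigcap_{n\ge 1}\alpha^n(M)$. An asymptotic lifting of $\alpha$ is a triple $(N,\beta,E)$ in which $N$ is a von Neumann algebra, $\beta$ is a $*$-automorphism of $N$, and $E:N\to M$ is a normal unital $*$-homomorphism, such that (1) $E\circ\beta=\alpha\circ E$; (2) (nondegeneracy) if $x\in N$ and $E(\beta^n(x))=0$ for every $n\in\mathbb Z$, then $x=0$; and (3) $E(N)=M_\infty$. Then $\alpha$ has an asymptotic lifting. Moreover, it is unique up to isomorphism: if $(N_1,\beta_1,E_1)$ and $(N_2,\beta_2,E_2)$ are asymptotic liftings of $\alpha$, there is a $*$-isomorphism $\gamma:N_1\to N_2$ with $\gamma\circ\beta_1=\beta_2\circ\gamma$ and $E_2\circ\gamma=E_1$. -/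

import Mathlib

universe u v w

section Lifting

variable {H : Type u} [NormedAddCommGroup H] [InnerProductSpace ℂ H] [CompleteSpace H]
variable {K : Type v} [NormedAddCommGroup K] [InnerProductSpace ℂ K] [CompleteSpace K]
variable {L : Type w} [NormedAddCommGroup L] [InnerProductSpace ℂ L] [CompleteSpace L]

/-- A linear functional `ρ` on a von Neumann algebra `M ⊆ B(H)` is normal (that is, ultraweakly
continuous, an element of the predual `M_*`) if it has the form `ρ x = ∑ₙ ⟪ξₙ, x ηₙ⟫` with
`∑ₙ ‖ξₙ‖² < ∞` and `∑ₙ ‖ηₙ‖² < ∞`. -/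
def IsNormalFunctional (M : VonNeumannAlgebra H) (ρ : M.toStarSubalgebra →ₗ[ℂ] ℂ) : Prop :=
  ∃ ξ η : ℕ → H, Summable (fun n => ‖ξ n‖ ^ 2) ∧ Summable (fun n => ‖η n‖ ^ 2) ∧
    ∀ x : M.toStarSubalgebra,
      HasSum (fun n => inner ℂ (ξ n) ((x : H →L[ℂ] H) (η n))) (ρ x)

/-- A unital `*`-homomorphism `Φ : N → M` of von Neumann algebras is normal if it is continuous
for the ultraweak (weak-`*`) topologies: `ρ ∘ Φ` is normal for every normal functional `ρ` on
`M`. -/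
def IsNormalHom {N : VonNeumannAlgebra K} {M : VonNeumannAlgebra H}
    (Φ : N.toStarSubalgebra →⋆ₐ[ℂ] M.toStarSubalgebra) : Prop :=
  ∀ ρ : M.toStarSubalgebra →ₗ[ℂ] ℂ, IsNormalFunctional M ρ →
    IsNormalFunctional N (ρ ∘ₗ Φ.toAlgHom.toLinearMap)

/-- The tail algebra `M_∞ = ⋂_{n ≥ 1} αⁿ(M)`, as a subset of `M`. -/
def tailAlgebra {M : VonNeumannAlgebra H}
    (α : M.toStarSubalgebra →⋆ₐ[ℂ] M.toStarSubalgebra) : Set M.toStarSubalgebra :=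
  ⋂ (n : ℕ) (_ : 1 ≤ n), Set.range (α^[n])

/-- `(N, β, E)` is a lifting of `α : M → M`: `β` is a `*`-automorphism of `N` and `E : N → M` is a
normal unital `*`-homomorphism with `E ∘ β = α ∘ E`. -/
structure IsLifting {M : VonNeumannAlgebra H} {N : VonNeumannAlgebra K}
    (α : M.toStarSubalgebra →⋆ₐ[ℂ] M.toStarSubalgebra)
    (β : N.toStarSubalgebra ≃⋆ₐ[ℂ] N.toStarSubalgebra)
    (E : N.toStarSubalgebra →⋆ₐ[ℂ] M.toStarSubalgebra) : Prop where
  normal : IsNormalHom E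
  intertwines : ∀ x, E (β x) = α (E x)

/-- An asymptotic lifting of `α`: a lifting `(N, β, E)` that is nondegenerate and satisfies
`E(N) = M_∞`. -/
structure IsAsymptoticLifting {M : VonNeumannAlgebra H} {N : VonNeumannAlgebra K}
    (α : M.toStarSubalgebra →⋆ₐ[ℂ] M.toStarSubalgebra)
    (β : N.toStarSubalgebra ≃⋆ₐ[ℂ] N.toStarSubalgebra)
    (E : N.toStarSubalgebra →⋆ₐ[ℂ] M.toStarSubalgebra) : Prop extends IsLifting α β E where
  nondegenerate : ∀ x, (∀ n : ℤ, E ((β ^ n) x) = 0) → x = 0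
  range_eq : Set.range E = tailAlgebra α

/-- Two triples `(N₁, β₁, E₁)` and `(N₂, β₂, E₂)` over `M` are isomorphic if some `*`-isomorphism
`γ : N₁ → N₂` satisfies `γ ∘ β₁ = β₂ ∘ γ` and `E₂ ∘ γ = E₁`. -/
def LiftingsIsomorphic {M : VonNeumannAlgebra H}
    {N₁ : VonNeumannAlgebra K} {N₂ : VonNeumannAlgebra L}
    (β₁ : N₁.toStarSubalgebra ≃⋆ₐ[ℂ] N₁.toStarSubalgebra)
    (E₁ : N₁.toStarSubalgebra →⋆ₐ[ℂ] M.toStarSubalgebra)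
    (β₂ : N₂.toStarSubalgebra ≃⋆ₐ[ℂ] N₂.toStarSubalgebra)
    (E₂ : N₂.toStarSubalgebra →⋆ₐ[ℂ] M.toStarSubalgebra) : Prop :=
  ∃ γ : N₁.toStarSubalgebra ≃⋆ₐ[ℂ] N₂.toStarSubalgebra,
    (∀ x, γ (β₁ x) = β₂ (γ x)) ∧ ∀ x, E₂ (γ x) = E₁ x

end Lifting

/-! The whole structure is encoded by bounded two-sided orbits of `α`: bounded sequences `c : ℤ → M`
with `c (n + 1) = α (c n)`. In any lifting, `x` yields the orbit `n ↦ E (βⁿ x)`. For an asymptotic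
lifting this is a bijection onto all bounded orbits. It is injective by nondegeneracy, and
surjective by weak compactness of balls together with `E(N) = M_∞`
(`IsAsymptoticLifting.exists_of_isBoundedOrbit`). Uniqueness follows by matching elements that have
the same orbit.

For existence, the bounded orbits themselves are taken as `N`, realized as diagonal operators on
`ℓ²(ℤ, H)`, with the shift as `β` and the entry at `0` as `E`. Compactness again shows that every
tail element lies on a bounded orbit (`exists_isBoundedOrbit`), so `E` has range `M_∞`. That the
diagonal operators form a von Neumann algebra comes from the bicommutant argument: the relation `c
(n + 1) = α (c n)` is ultraweakly closed because `α` is normal (`orbit_of_mem_bicommutant`). -/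

open Filter Topology CStarAlgebra

/-! ### Bounded lifts and approximate units for `*`-homomorphisms -/

section CStar

variable {A : Type*} {B : Type*} [CStarAlgebra A] [CStarAlgebra B]

/-- Self-adjoint elements of the range of a `*`-homomorphism lift without increasing the norm. -/
lemma StarAlgHom.exists_norm_le_of_isSelfAdjoint (φ : A →⋆ₐ[ℂ] B) {a : A} (ha : IsSelfAdjoint a) :
    ∃ a', φ a' = φ a ∧ ‖a'‖ ≤ ‖φ a‖ := by
  set r := ‖φ a‖ with hr
  have hr0 : 0 ≤ r := norm_nonneg _
  -- Truncation to `[-r, r]` bounds `f(a)` by `r`, and it is the identity on the spectrum of `φ a`,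
  -- so `φ (f(a)) = f(φ a) = φ a`.
  let f : ℝ → ℝ := fun t => max (-r) (min t r)
  have hf : Continuous f := by fun_prop
  have hφa : IsSelfAdjoint (φ a) := ha.map φ
  refine ⟨cfc f a, ?_, ?_⟩
  · rw [StarAlgHomClass.map_cfc φ f a hf.continuousOn]
    conv_rhs => rw [← cfc_id' ℝ (φ a)]
    refine cfc_congr fun t ht => ?_
    have : ‖t‖ ≤ r := by
      have h := norm_apply_le_norm_cfc (fun x : ℝ => x) (φ a) ht
      rwa [cfc_id' ℝ (φ a)] at h
    rw [Real.norm_eq_abs, abs_le] at this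
    simp [f, this.1, this.2]
  · refine norm_cfc_le hr0 fun t _ => ?_
    rw [Real.norm_eq_abs, abs_le]
    exact ⟨le_max_left _ _, max_le (by linarith) (min_le_right _ _)⟩

/-- Every element of the range of a `*`-homomorphism has a preimage of comparable norm. -/
lemma StarAlgHom.exists_norm_le (φ : A →⋆ₐ[ℂ] B) (a : A) :
    ∃ a', φ a' = φ a ∧ ‖a'‖ ≤ 2 * ‖φ a‖ := by
  obtain ⟨x, hx, hxn⟩ := φ.exists_norm_le_of_isSelfAdjoint (realPart a).2
  obtain ⟨y, hy, hyn⟩ := φ.exists_norm_le_of_isSelfAdjoint (imaginaryPart a).2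
  have hre : φ (realPart a) = realPart (φ a) := by
    simp [realPart_apply_coe, ← Complex.coe_smul, map_star]
  have him : φ (imaginaryPart a) = imaginaryPart (φ a) := by
    simp [imaginaryPart_apply_coe, ← Complex.coe_smul, map_star]
  refine ⟨x + Complex.I • y, ?_, ?_⟩
  · rw [map_add, map_smul, hx, hy, ← map_smul, ← map_add, realPart_add_I_smul_imaginaryPart]
  · rw [hre] at hxn
    rw [him] at hyn
    have h1 := realPart.norm_le (φ a)
    have h2 := imaginaryPart.norm_le (φ a)
    calc ‖x + Complex.I • y‖ ≤ ‖x‖ + ‖Complex.I • y‖ := norm_add_le _ _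
      _ = ‖x‖ + ‖y‖ := by rw [norm_smul]; simp
      _ ≤ ‖φ a‖ + ‖φ a‖ := add_le_add (hxn.trans h1) (hyn.trans h2)
      _ = 2 * ‖φ a‖ := (two_mul _).symm

/-- The kernel of a `*`-homomorphism has a contractive approximate unit. -/
lemma StarAlgHom.exists_approximateUnit_ker (φ : A →⋆ₐ[ℂ] B) :
    ∃ l : Filter A, l.NeBot ∧ (∀ᶠ u in l, φ u = 0 ∧ ‖u‖ ≤ 1) ∧
      ∀ x, φ x = 0 → Tendsto (fun u => u * x) l (𝓝 x) := by
  -- The kernel is norm closed, hence a non-unital C*-algebra with its own approximate unit.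
  let J : NonUnitalStarSubalgebra ℂ A :=
    { carrier := {x | φ x = 0}
      add_mem' := fun {a b} ha hb => by simp_all
      zero_mem' := by simp
      mul_mem' := fun {a b} ha hb => by simp_all
      smul_mem' := fun c x hx => by simp_all
      star_mem' := fun {a} ha => by simp_all [map_star] }
  have hJ : IsClosed (J : Set A) := isClosed_singleton.preimage (map_continuous φ)
  let _ : NonUnitalCStarAlgebra J := NonUnitalStarSubalgebra.nonUnitalCStarAlgebra J
  let _ : PartialOrder J := CStarAlgebra.spectralOrder J
  have : StarOrderedRing J := CStarAlgebra.spectralOrderedRing J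
  have h := CStarAlgebra.increasingApproximateUnit J
  have := h.neBot
  refine ⟨(CStarAlgebra.approximateUnit J).map (Subtype.val : J → A), inferInstance, ?_, ?_⟩
  · rw [eventually_map]
    filter_upwards [h.eventually_norm] with u hu
    exact ⟨u.2, hu⟩
  · intro x hx
    rw [tendsto_map'_iff]
    exact (continuous_subtype_val.tendsto _).comp (h.tendsto_mul_right ⟨x, hx⟩)

end CStar

/-! ### Weak operator limits along ultrafilters -/

section WeakLimit

variable {H : Type u} [NormedAddCommGroup H] [InnerProductSpace ℂ H]

/-- Convergence in the weak operator topology. -/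
def WeaklyTendsto {κ : Type*} (a : κ → H →L[ℂ] H) (l : Filter κ) (b : H →L[ℂ] H) : Prop :=
  ∀ ξ η : H, Tendsto (fun i => inner ℂ ξ (a i η)) l (𝓝 (inner ℂ ξ (b η)))

lemma WeaklyTendsto.unique {κ : Type*} {a : κ → H →L[ℂ] H} {l : Filter κ} [l.NeBot]
    {b c : H →L[ℂ] H} (hb : WeaklyTendsto a l b) (hc : WeaklyTendsto a l c) : b = c :=
  ContinuousLinearMap.ext fun η => ext_inner_left ℂ fun ξ =>
    tendsto_nhds_unique (hb ξ η) (hc ξ η)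

lemma WeaklyTendsto.congr' {κ : Type*} {a a' : κ → H →L[ℂ] H} {l : Filter κ}
    {b : H →L[ℂ] H} (hb : WeaklyTendsto a l b) (h : a =ᶠ[l] a') : WeaklyTendsto a' l b :=
  fun ξ η => (hb ξ η).congr' (h.mono fun i hi => by simp only [hi])

lemma WeaklyTendsto.mul_right {κ : Type*} {a : κ → H →L[ℂ] H} {l : Filter κ}
    {b : H →L[ℂ] H} (hb : WeaklyTendsto a l b) (c : H →L[ℂ] H) :
    WeaklyTendsto (fun i => a i * c) l (b * c) := fun ξ η => hb ξ (c η)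

lemma Filter.Tendsto.weaklyTendsto {κ : Type*} {a : κ → H →L[ℂ] H} {l : Filter κ}
    {b : H →L[ℂ] H} (hb : Tendsto a l (𝓝 b)) : WeaklyTendsto a l b := fun _ η =>
  (((continuous_const.inner continuous_id).tendsto _).comp
    (((ContinuousLinearMap.apply ℂ H η).continuous.tendsto b).comp hb))

variable [CompleteSpace H]

lemma WeaklyTendsto.mul_left {κ : Type*} {a : κ → H →L[ℂ] H} {l : Filter κ}
    {b : H →L[ℂ] H} (hb : WeaklyTendsto a l b) (c : H →L[ℂ] H) :
    WeaklyTendsto (fun i => c * a i) l (c * b) := fun ξ η => by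
  simpa [ContinuousLinearMap.adjoint_inner_left] using! hb (ContinuousLinearMap.adjoint c ξ) η

/-- Bounded families of operators converge weakly along ultrafilters. -/
lemma exists_weaklyTendsto_ultrafilter {κ : Type*} (U : Ultrafilter κ) (a : κ → H →L[ℂ] H) {C : ℝ}
    (hC : 0 ≤ C) (ha : ∀ᶠ i in (U : Filter κ), ‖a i‖ ≤ C) :
    ∃ b : H →L[ℂ] H, ‖b‖ ≤ C ∧ WeaklyTendsto a U b := by
  have hbd : ∀ ξ η : H, ∀ᶠ i in (U : Filter κ), ‖inner ℂ (a i ξ) η‖ ≤ C * ‖ξ‖ * ‖η‖ := by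
    intro ξ η
    filter_upwards [ha] with i hi
    exact (norm_inner_le_norm _ _).trans
      (mul_le_mul_of_nonneg_right ((a i).le_of_opNorm_le hi ξ) (norm_nonneg _))
  have hlim : ∀ ξ η : H, ∃ z : ℂ, ‖z‖ ≤ C * ‖ξ‖ * ‖η‖ ∧
      Tendsto (fun i => inner ℂ (a i ξ) η) U (𝓝 z) := by
    intro ξ η
    obtain ⟨z, hz, hzU⟩ := (isCompact_closedBall (0 : ℂ) (C * ‖ξ‖ * ‖η‖)).ultrafilter_le_nhds
      (U.map fun i => inner ℂ (a i ξ) η) (by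
        rw [le_principal_iff]
        exact (hbd ξ η).mono fun i hi => by simpa using hi)
    exact ⟨z, by simpa using hz, hzU⟩
  choose B hB hBt using hlim
  have huniq : ∀ {ξ η z}, Tendsto (fun i => inner ℂ (a i ξ) η) U (𝓝 z) → B ξ η = z :=
    fun {ξ η z} h => tendsto_nhds_unique (hBt ξ η) h
  -- The pointwise limits form a bounded sesquilinear form, which the Riesz theorem represents by an
  -- operator.
  let S : H →ₗ⋆[ℂ] H →ₗ[ℂ] ℂ := LinearMap.mk₂'ₛₗ (starRingEnd ℂ) (RingHom.id ℂ) B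
    (fun x y z => huniq (by simpa [inner_add_left] using (hBt x z).add (hBt y z)))
    (fun c x y => huniq (by
      simpa [inner_smul_left, mul_comm] using (hBt x y).const_mul (starRingEnd ℂ c)))
    (fun x y z => huniq (by simpa [inner_add_right] using (hBt x y).add (hBt x z)))
    (fun c x y => huniq (by simpa [inner_smul_right] using (hBt x y).const_mul c))
  let S' : H →L⋆[ℂ] H →L[ℂ] ℂ := S.mkContinuous₂ C hB
  let b := InnerProductSpace.continuousLinearMapOfBilin S'
  have hb : ∀ v w, inner ℂ (b v) w = B v w :=
    fun v w => InnerProductSpace.continuousLinearMapOfBilin_apply S' v w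
  refine ⟨b, ?_, fun ξ η => ?_⟩
  · refine ContinuousLinearMap.opNorm_le_bound _ hC fun v => ?_
    have h1 : ‖inner ℂ (b v) (b v)‖ ≤ C * ‖v‖ * ‖b v‖ := by rw [hb]; exact hB _ _
    rw [inner_self_eq_norm_sq_to_K, norm_pow, RCLike.norm_ofReal, abs_norm] at h1
    rcases (norm_nonneg (b v)).eq_or_lt with h0 | h0
    · rw [← h0]; positivity
    · nlinarith
  · have := (hBt η ξ).star
    rw [← hb] at this
    simpa [← starRingEnd_apply] using this

end WeakLimit

/-! ### Weak compactness and normal homomorphisms -/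

section VonNeumann

variable {H : Type u} [NormedAddCommGroup H] [InnerProductSpace ℂ H] [CompleteSpace H]
variable {K : Type v} [NormedAddCommGroup K] [InnerProductSpace ℂ K] [CompleteSpace K]

/-- A von Neumann algebra is closed in the weak operator topology. -/
lemma VonNeumannAlgebra.mem_of_weaklyTendsto (M : VonNeumannAlgebra H) {κ : Type*}
    {l : Filter κ} [l.NeBot] {a : κ → H →L[ℂ] H} {b : H →L[ℂ] H}
    (ha : ∀ᶠ i in l, a i ∈ M) (h : WeaklyTendsto a l b) : b ∈ M := by
  rw [← M.commutant_commutant, VonNeumannAlgebra.mem_commutant_iff]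
  intro c hc
  refine (h.mul_left c).unique ((h.mul_right c).congr' ?_)
  filter_upwards [ha] with i hi
  exact VonNeumannAlgebra.mem_commutant_iff.1 hc _ hi

instance VonNeumannAlgebra.isClosed_toStarSubalgebra (M : VonNeumannAlgebra H) :
    IsClosed (M.toStarSubalgebra : Set (H →L[ℂ] H)) := by
  rw [VonNeumannAlgebra.coe_toStarSubalgebra, ← M.centralizer_centralizer]
  exact Set.isClosed_centralizer _

/-- Bounded families in a von Neumann algebra converge weakly along ultrafilters to elements of
the algebra. -/
lemma VonNeumannAlgebra.exists_weaklyTendsto_ultrafilter (M : VonNeumannAlgebra H) {κ : Type*}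
    (U : Ultrafilter κ) (a : κ → M.toStarSubalgebra) {C : ℝ} (hC : 0 ≤ C)
    (ha : ∀ᶠ i in (U : Filter κ), ‖a i‖ ≤ C) :
    ∃ b : M.toStarSubalgebra, ‖b‖ ≤ C ∧
      WeaklyTendsto (fun i => (a i : H →L[ℂ] H)) U (b : H →L[ℂ] H) := by
  obtain ⟨b, hb, h⟩ := _root_.exists_weaklyTendsto_ultrafilter U
    (fun i => (a i : H →L[ℂ] H)) hC ha
  exact ⟨⟨b, M.mem_of_weaklyTendsto (.of_forall fun i => (a i).2) h⟩, hb, h⟩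

lemma summable_norm_mul_norm {ι E F : Type*} [NormedAddCommGroup E] [NormedAddCommGroup F]
    {ξ : ι → E} {η : ι → F}
    (hξ : Summable fun n => ‖ξ n‖ ^ 2) (hη : Summable fun n => ‖η n‖ ^ 2) :
    Summable fun n => ‖ξ n‖ * ‖η n‖ :=
  .of_nonneg_of_le (fun n => by positivity) (fun n => by nlinarith [two_mul_le_add_sq ‖ξ n‖ ‖η n‖])
    (hξ.add hη)

lemma isNormalFunctional_inner (M : VonNeumannAlgebra H) (ξ η : H) :
    ∃ ρ : M.toStarSubalgebra →ₗ[ℂ] ℂ, IsNormalFunctional M ρ ∧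
      ∀ x : M.toStarSubalgebra, ρ x = inner ℂ ξ ((x : H →L[ℂ] H) η) := by
  refine ⟨{ toFun := fun x => inner ℂ ξ ((x : H →L[ℂ] H) η)
            map_add' := fun x y => by simp
            map_smul' := fun c x => by simp }, ?_, fun x => rfl⟩
  refine ⟨Pi.single 0 ξ, Pi.single 0 η, ?_, ?_, fun x => ?_⟩
  · exact summable_of_ne_finset_zero (s := {0}) fun n hn => by
      simp [Pi.single_eq_of_ne (Finset.notMem_singleton.1 hn)]
  · exact summable_of_ne_finset_zero (s := {0}) fun n hn => by
      simp [Pi.single_eq_of_ne (Finset.notMem_singleton.1 hn)]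
  · convert hasSum_single 0 fun n hn => ?_
    · simp
    · simp [Pi.single_eq_of_ne hn]

/-- Normal homomorphisms are weakly continuous on bounded sets. -/
lemma IsNormalHom.weaklyTendsto {N : VonNeumannAlgebra K} {M : VonNeumannAlgebra H}
    {Φ : N.toStarSubalgebra →⋆ₐ[ℂ] M.toStarSubalgebra} (hΦ : IsNormalHom Φ) {κ : Type*}
    {l : Filter κ} {a : κ → N.toStarSubalgebra} {b : N.toStarSubalgebra} {C : ℝ}
    (ha : ∀ᶠ i in l, ‖a i‖ ≤ C)
    (h : WeaklyTendsto (fun i => (a i : K →L[ℂ] K)) l (b : K →L[ℂ] K)) :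
    WeaklyTendsto (fun i => (Φ (a i) : H →L[ℂ] H)) l (Φ b : H →L[ℂ] H) := by
  intro ξ η
  obtain ⟨ρ, hρ, hρe⟩ := isNormalFunctional_inner M ξ η
  obtain ⟨ξ', η', hξ', hη', hs⟩ := hΦ ρ hρ
  have key : ∀ x : N.toStarSubalgebra, inner ℂ ξ ((Φ x : H →L[ℂ] H) η) =
      ∑' n, inner ℂ (ξ' n) ((x : K →L[ℂ] K) (η' n)) := fun x => by
    rw [(hs x).tsum_eq, ← hρe]; rfl
  simp only [key]
  -- The pulled-back functional involves infinitely many vectors; the bound `C` supplies the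
  -- summable majorant.
  refine tendsto_tsum_of_dominated_convergence (bound := fun n => C * (‖ξ' n‖ * ‖η' n‖))
    ((summable_norm_mul_norm hξ' hη').mul_left C) (fun n => h _ _) ?_
  filter_upwards [ha] with i hi n
  have h1 : ‖(a i : K →L[ℂ] K) (η' n)‖ ≤ C * ‖η' n‖ :=
    ContinuousLinearMap.le_of_opNorm_le _ hi _
  calc _ ≤ ‖ξ' n‖ * ‖(a i : K →L[ℂ] K) (η' n)‖ := norm_inner_le_norm _ _
    _ ≤ ‖ξ' n‖ * (C * ‖η' n‖) := by gcongr
    _ = _ := by ring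

/-- A normal homomorphism admits an element which is mapped to `1` and annihilates the kernel. -/
lemma IsNormalHom.exists_support {N : VonNeumannAlgebra K} {M : VonNeumannAlgebra H}
    {Φ : N.toStarSubalgebra →⋆ₐ[ℂ] M.toStarSubalgebra} (hΦ : IsNormalHom Φ) :
    ∃ e : N.toStarSubalgebra, Φ e = 1 ∧ ∀ x, Φ x = 0 → e * x = 0 := by
  obtain ⟨l, hl, hker, hunit⟩ := Φ.exists_approximateUnit_ker
  let U := Ultrafilter.of l
  have hU : (U : Filter _) ≤ l := Ultrafilter.of_le l
  have hn : ∀ᶠ u in (U : Filter N.toStarSubalgebra), ‖u‖ ≤ 1 := (hker.filter_mono hU).mono fun u hu => hu.2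
  obtain ⟨b, -, hb⟩ := N.exists_weaklyTendsto_ultrafilter U id zero_le_one hn
  have hΦb : Φ b = 0 := by
    refine Subtype.ext ((hΦ.weaklyTendsto hn hb).unique
      (Filter.Tendsto.weaklyTendsto (tendsto_const_nhds.congr' ?_)))
    filter_upwards [hker.filter_mono hU] with u hu
    simp [hu.1]
  -- The weak limit `b` of the approximate unit stays in the kernel by normality and acts there as a
  -- left unit, so `1 - b` annihilates the kernel.
  refine ⟨1 - b, by simp [hΦb], fun x hx => ?_⟩
  have hbx : b * x = x := by
    refine Subtype.ext ((hb.mul_right (x : K →L[ℂ] K)).unique (Filter.Tendsto.weaklyTendsto ?_))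
    exact (continuous_subtype_val.tendsto _).comp ((hunit x hx).mono_left hU)
  rw [sub_mul, one_mul, hbx, sub_self]

end VonNeumann

/-! ### Integer powers of automorphisms -/

section Zpow

variable {A : Type*} [NonUnitalNonAssocSemiring A] [Module ℂ A] [Star A]

lemma StarAlgEquiv.zpow_add_apply (β : A ≃⋆ₐ[ℂ] A) (m n : ℤ) (x : A) :
    (β ^ (m + n)) x = (β ^ m) ((β ^ n) x) := by
  rw [zpow_add]; rfl

lemma StarAlgEquiv.zpow_zero_apply (β : A ≃⋆ₐ[ℂ] A) (x : A) : (β ^ (0 : ℤ)) x = x := by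
  rw [zpow_zero]; rfl

lemma StarAlgEquiv.zpow_one_add_apply (β : A ≃⋆ₐ[ℂ] A) (n : ℤ) (x : A) :
    (β ^ (1 + n)) x = β ((β ^ n) x) := by
  rw [zpow_add_apply, zpow_one]

lemma StarAlgEquiv.zpow_add_one_apply (β : A ≃⋆ₐ[ℂ] A) (n : ℤ) (x : A) :
    (β ^ (n + 1)) x = (β ^ n) (β x) := by
  rw [zpow_add_apply, zpow_one]

lemma StarAlgEquiv.apply_zpow_of_apply_eq {B : Type*} (β : A ≃⋆ₐ[ℂ] A) (φ : ℤ → A → B)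
    (hφ : ∀ n x, φ n (β x) = φ (n + 1) x) (k n : ℤ) (x : A) :
    φ n ((β ^ k) x) = φ (n + k) x := by
  induction k generalizing n with
  | zero => rw [zpow_zero_apply, add_zero]
  | succ k ih =>
    rw [add_comm, zpow_one_add_apply, hφ, ih]
    congr 1
    ring
  | pred k ih =>
    have h := hφ (n - 1) ((β ^ (-(k : ℤ) - 1)) x)
    rw [← zpow_one_add_apply, add_sub_cancel, ih, sub_add_cancel] at h
    rw [← h]
    congr 1
    ring

end Zpow

/-! ### Bounded orbits and uniqueness -/

section Orbits

variable {H : Type u} [NormedAddCommGroup H] [InnerProductSpace ℂ H] [CompleteSpace H]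
variable {K : Type v} [NormedAddCommGroup K] [InnerProductSpace ℂ K] [CompleteSpace K]
variable {L : Type w} [NormedAddCommGroup L] [InnerProductSpace ℂ L] [CompleteSpace L]

/-- A bounded two-sided orbit of an endomorphism. -/
structure IsBoundedOrbit {M : VonNeumannAlgebra H}
    (α : M.toStarSubalgebra →⋆ₐ[ℂ] M.toStarSubalgebra) (c : ℤ → M.toStarSubalgebra) : Prop where
  map : ∀ n, c (n + 1) = α (c n)
  bounded : ∃ C : ℝ, 0 ≤ C ∧ ∀ n, ‖c n‖ ≤ C

lemma IsBoundedOrbit.iterate {M : VonNeumannAlgebra H}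
    {α : M.toStarSubalgebra →⋆ₐ[ℂ] M.toStarSubalgebra} {c : ℤ → M.toStarSubalgebra}
    (hc : IsBoundedOrbit α c) (n : ℤ) (k : ℕ) : c (n + k) = α^[k] (c n) := by
  induction k with
  | zero => simp
  | succ k ih => rw [Function.iterate_succ_apply', ← ih, ← hc.map]; congr 1; push_cast; ring

lemma IsBoundedOrbit.shift {M : VonNeumannAlgebra H}
    {α : M.toStarSubalgebra →⋆ₐ[ℂ] M.toStarSubalgebra} {c : ℤ → M.toStarSubalgebra}
    (hc : IsBoundedOrbit α c) (k : ℤ) : IsBoundedOrbit α fun n => c (n + k) where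
  map n := by rw [← hc.map]; congr 1; ring
  bounded := hc.bounded.imp fun _ hC => ⟨hC.1, fun n => hC.2 (n + k)⟩

lemma IsBoundedOrbit.mem_tailAlgebra {M : VonNeumannAlgebra H}
    {α : M.toStarSubalgebra →⋆ₐ[ℂ] M.toStarSubalgebra} {c : ℤ → M.toStarSubalgebra}
    (hc : IsBoundedOrbit α c) (n : ℤ) : c n ∈ tailAlgebra α := by
  refine Set.mem_iInter₂.2 fun k _ => ⟨c (n - k), ?_⟩
  rw [← hc.iterate, sub_add_cancel]

lemma StarAlgHom.exists_coe_eq_iterate {A : Type*} [Semiring A] [Algebra ℂ A] [Star A]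
    (α : A →⋆ₐ[ℂ] A) (n : ℕ) : ∃ φ : A →⋆ₐ[ℂ] A, ⇑φ = α^[n] := by
  induction n with
  | zero => exact ⟨StarAlgHom.id ℂ A, rfl⟩
  | succ n ih =>
    obtain ⟨φ, hφ⟩ := ih
    exact ⟨φ.comp α, by rw [StarAlgHom.coe_comp, hφ, Function.iterate_succ]⟩

/-- Every element of the tail algebra of a normal endomorphism lies on a bounded two-sided
orbit. -/
lemma exists_isBoundedOrbit {M : VonNeumannAlgebra H}
    {α : M.toStarSubalgebra →⋆ₐ[ℂ] M.toStarSubalgebra} (hα : IsNormalHom α)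
    {x : M.toStarSubalgebra} (hx : x ∈ tailAlgebra α) :
    ∃ c, IsBoundedOrbit α c ∧ c 0 = x := by
  have hy : ∀ m : ℕ, ∃ y, α^[m] y = x ∧ ‖y‖ ≤ 2 * ‖x‖ := by
    intro m
    obtain ⟨z, hz⟩ : x ∈ Set.range α^[m] := by
      rcases Nat.eq_zero_or_pos m with rfl | hm
      · exact ⟨x, rfl⟩
      · exact Set.mem_iInter₂.1 hx m hm
    obtain ⟨φ, hφ⟩ := α.exists_coe_eq_iterate m
    obtain ⟨y, hy, hyn⟩ := φ.exists_norm_le z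
    rw [hφ, hz] at hy hyn
    exact ⟨y, hy, hyn⟩
  choose y hy hyn using hy
  have hC : 0 ≤ 2 * ‖x‖ := by positivity
  let U : Ultrafilter ℕ := Ultrafilter.of atTop
  have hU : (U : Filter ℕ) ≤ atTop := Ultrafilter.of_le _
  have hbd : ∀ (n : ℤ) (m : ℕ), ‖α^[(n + m).toNat] (y m)‖ ≤ 2 * ‖x‖ := by
    intro n m
    obtain ⟨φ, hφ⟩ := α.exists_coe_eq_iterate (n + m).toNat
    rw [← hφ]
    exact (NonUnitalStarAlgHom.norm_apply_le φ (y m)).trans (hyn m)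
  -- The entry `c n` is the limit of `α^(n+m) (y m)`, formally `αⁿ x`. Truncation by `toNat` affects
  -- only finitely many `m`.
  choose c hcn hc using fun n : ℤ =>
    M.exists_weaklyTendsto_ultrafilter U (fun m => α^[(n + m).toNat] (y m)) hC
      (.of_forall (hbd n))
  refine ⟨c, ⟨fun n => ?_, _, hC, hcn⟩, ?_⟩
  · refine Subtype.ext ((hc (n + 1)).unique
      ((hα.weaklyTendsto (.of_forall (hbd n)) (hc n)).congr' (hU ?_)))
    filter_upwards [eventually_ge_atTop (-n).toNat] with m hm
    rw [← Function.iterate_succ_apply' α]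
    congr 3
    lia
  · refine Subtype.ext ((hc 0).unique (Filter.Tendsto.weaklyTendsto ?_))
    simp [hy]

variable {M : VonNeumannAlgebra H} {N : VonNeumannAlgebra K}
  {α : M.toStarSubalgebra →⋆ₐ[ℂ] M.toStarSubalgebra}
  {β : N.toStarSubalgebra ≃⋆ₐ[ℂ] N.toStarSubalgebra}
  {E : N.toStarSubalgebra →⋆ₐ[ℂ] M.toStarSubalgebra}

lemma IsLifting.isBoundedOrbit (h : IsLifting α β E) (x : N.toStarSubalgebra) :
    IsBoundedOrbit α fun n => E ((β ^ n) x) where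
  map n := by rw [← h.intertwines, add_comm, StarAlgEquiv.zpow_one_add_apply]
  bounded := ⟨‖x‖, norm_nonneg _, fun n => (NonUnitalStarAlgHom.norm_apply_le E _).trans
    (NonUnitalStarAlgHom.norm_apply_le (β ^ n) x)⟩

/-- Every bounded two-sided orbit of `α` comes from an element of an asymptotic lifting. -/
lemma IsAsymptoticLifting.exists_of_isBoundedOrbit (h : IsAsymptoticLifting α β E)
    {c : ℤ → M.toStarSubalgebra} (hc : IsBoundedOrbit α c) :
    ∃ y, ∀ n : ℤ, E ((β ^ n) y) = c n := by
  obtain ⟨C, hC, hcC⟩ := hc.bounded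
  have hy : ∀ m : ℕ, ∃ y, E y = c (-m) ∧ ‖y‖ ≤ 2 * C := by
    intro m
    obtain ⟨z, hz⟩ : c (-m) ∈ Set.range E := h.range_eq ▸ hc.mem_tailAlgebra _
    obtain ⟨y, hy, hyn⟩ := E.exists_norm_le z
    rw [hz] at hy hyn
    exact ⟨y, hy, hyn.trans (by gcongr; exact hcC _)⟩
  choose y hy hyn using hy
  let U : Ultrafilter ℕ := Ultrafilter.of atTop
  have hU : (U : Filter ℕ) ≤ atTop := Ultrafilter.of_le _
  -- Each `βᵐ (y m)` already has the prescribed orbit at all indices `n ≥ -m`.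
  obtain ⟨z, -, hz⟩ := N.exists_weaklyTendsto_ultrafilter U (fun m => (β ^ (m : ℤ)) (y m))
    (by positivity : 0 ≤ 2 * C) (.of_forall fun m =>
      (NonUnitalStarAlgHom.norm_apply_le (β ^ (m : ℤ)) (y m)).trans (hyn m))
  obtain ⟨e, he, hker⟩ := h.normal.exists_support
  refine ⟨z, fun n => ?_⟩
  have hval : ∀ m : ℕ, (-n).toNat ≤ m → E ((β ^ n) ((β ^ (m : ℤ)) (y m))) = c n := by
    intro m hm
    obtain ⟨k, hk⟩ : ∃ k : ℕ, n + m = k := ⟨(n + m).toNat, by lia⟩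
    have h1 := (h.isBoundedOrbit (y m)).iterate 0 k
    have h2 := hc.iterate (-m) k
    rw [show -(m : ℤ) + k = n by lia] at h2
    rw [← StarAlgEquiv.zpow_add_apply, hk, h2, ← hy]
    rwa [zero_add, StarAlgEquiv.zpow_zero_apply] at h1
  -- Multiplying by `p` replaces any appeal to normality of `β`: `p` kills the kernel of `E ∘ βⁿ`,
  -- so `p * βᵐ (y m)` is eventually constant in `m`. Its weak limit `p * z` is that constant, and
  -- `E (βⁿ p) = 1` recovers `c n`.
  let p := (β ^ (-n)) e
  have hp : (β ^ n) p = e := by 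
    rw [← StarAlgEquiv.zpow_add_apply, add_neg_cancel, StarAlgEquiv.zpow_zero_apply]
  have hpz : p * z = p * (β ^ (((-n).toNat : ℕ) : ℤ)) (y (-n).toNat) := by
    refine Subtype.ext ((hz.mul_left (p : K →L[ℂ] K)).unique
      (Filter.Tendsto.weaklyTendsto (tendsto_const_nhds.congr' (hU ?_))))
    filter_upwards [eventually_ge_atTop (-n).toNat] with m hm
    have h0 : p * ((β ^ (((-n).toNat : ℕ) : ℤ)) (y (-n).toNat) - (β ^ (m : ℤ)) (y m)) = 0 := by
      refine (map_eq_zero_iff (β ^ n) (EquivLike.injective (β ^ n))).1 ?_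
      rw [map_mul, hp]
      apply hker
      rw [map_sub, map_sub, hval _ le_rfl, hval _ hm, sub_self]
    rw [mul_sub, sub_eq_zero] at h0
    exact congrArg Subtype.val h0
  have h3 := congrArg (fun t => E ((β ^ n) t)) hpz
  simpa only [map_mul, hp, he, one_mul, hval _ le_rfl] using h3

lemma IsAsymptoticLifting.ext (h : IsAsymptoticLifting α β E) {x y : N.toStarSubalgebra}
    (hxy : ∀ n : ℤ, E ((β ^ n) x) = E ((β ^ n) y)) : x = y :=
  sub_eq_zero.1 (h.nondegenerate _ fun n => by rw [map_sub, map_sub, hxy, sub_self])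

variable {N₂ : VonNeumannAlgebra L} {β₂ : N₂.toStarSubalgebra ≃⋆ₐ[ℂ] N₂.toStarSubalgebra}
  {E₂ : N₂.toStarSubalgebra →⋆ₐ[ℂ] M.toStarSubalgebra}

/-- Elements with equal orbits correspond. Each algebraic identity is checked on orbits, where
operations are pointwise and `β` acts as the shift. -/
theorem IsAsymptoticLifting.liftingsIsomorphic (h : IsAsymptoticLifting α β E)
    (h₂ : IsAsymptoticLifting α β₂ E₂) : LiftingsIsomorphic β E β₂ E₂ := by
  choose f hf using fun x => h₂.exists_of_isBoundedOrbit (h.isBoundedOrbit x)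
  choose g hg using fun x => h.exists_of_isBoundedOrbit (h₂.isBoundedOrbit x)
  let γ : N.toStarSubalgebra ≃⋆ₐ[ℂ] N₂.toStarSubalgebra :=
    { toFun := f
      invFun := g
      left_inv := fun x => h.ext fun n => by rw [hg, hf]
      right_inv := fun x => h₂.ext fun n => by rw [hf, hg]
      map_mul' := fun x y => h₂.ext fun n => by simp only [hf, map_mul]
      map_add' := fun x y => h₂.ext fun n => by simp only [hf, map_add]
      map_star' := fun x => h₂.ext fun n => by simp only [hf, map_star]
      map_smul' := fun r x => h₂.ext fun n => by simp only [hf, map_smul] }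
  refine ⟨γ, fun x => h₂.ext fun n => ?_, fun x => ?_⟩
  swap
  · have h0 := hf x 0
    rwa [StarAlgEquiv.zpow_zero_apply, StarAlgEquiv.zpow_zero_apply] at h0
  change E₂ ((β₂ ^ n) (f (β x))) = E₂ ((β₂ ^ n) (β₂ (f x)))
  rw [hf, ← StarAlgEquiv.zpow_add_one_apply, ← StarAlgEquiv.zpow_add_one_apply, hf]

end Orbits

/-! ### Amplification and the bicommutant theorem -/

section Amplification

variable {K : Type v} [NormedAddCommGroup K] [InnerProductSpace ℂ K] {ι : Type*}

/-- The diagonal operator on `ℓ²(ι, K)` with constant entry `x`. -/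
noncomputable def amplify (ι : Type*) (x : K →L[ℂ] K) :
    lp (fun _ : ι => K) 2 →L[ℂ] lp (fun _ : ι => K) 2 :=
  lp.mapCLM 2 (fun _ => x) (norm_nonneg x) (fun _ => le_rfl)

@[simp]
lemma amplify_apply (x : K →L[ℂ] K) (v : lp (fun _ : ι => K) 2) (i : ι) :
    amplify ι x v i = x (v i) := rfl

/-- The operator on `ℓ²(ℤ, K)` acting as `s` in the coordinate `n` and as `0` in the others. -/
noncomputable def atCoord (n : ℤ) (s : K →L[ℂ] K) :
    lp (fun _ : ℤ => K) 2 →L[ℂ] lp (fun _ : ℤ => K) 2 :=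
  (lp.singleContinuousLinearMap ℂ (fun _ : ℤ => K) 2 n) ∘L s ∘L
    (lp.evalCLM ℂ (fun _ : ℤ => K) 2 n)

lemma atCoord_apply (n : ℤ) (s : K →L[ℂ] K) (v : lp (fun _ : ℤ => K) 2) :
    atCoord n s v = lp.single 2 n (s (v n)) := rfl

variable [CompleteSpace K]

lemma inner_amplify_left (x : K →L[ℂ] K) (v w : lp (fun _ : ι => K) 2) :
    inner ℂ (amplify ι x v) w = inner ℂ v (amplify ι (star x) w) := by
  simp [lp.inner_eq_tsum, ContinuousLinearMap.star_eq_adjoint,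
    ContinuousLinearMap.adjoint_inner_right]

/-- The submodule of all `(x ηᵢ)ᵢ` with `x ∈ A`. -/
def amplifiedOrbit (A : StarSubalgebra ℂ (K →L[ℂ] K)) (η : lp (fun _ : ι => K) 2) :
    Submodule ℂ (lp (fun _ : ι => K) 2) where
  carrier := {v | ∃ x ∈ A, amplify ι x η = v}
  add_mem' := by
    rintro _ _ ⟨x, hx, rfl⟩ ⟨y, hy, rfl⟩
    exact ⟨x + y, add_mem hx hy, lp.ext (funext fun i => by simp)⟩
  zero_mem' := ⟨0, zero_mem _, lp.ext (funext fun i => by simp)⟩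
  smul_mem' := by
    rintro c _ ⟨x, hx, rfl⟩
    exact ⟨c • x, A.smul_mem hx c, lp.ext (funext fun i => by simp)⟩

/-- The bicommutant theorem, in the form: ultraweakly continuous functionals vanishing on a
unital `*`-algebra `A` of operators vanish on its bicommutant. -/
lemma StarSubalgebra.tsum_inner_eq_zero_of_mem_bicommutant (A : StarSubalgebra ℂ (K →L[ℂ] K))
    {T : K →L[ℂ] K} (hT : T ∈ Set.centralizer (Set.centralizer (A : Set (K →L[ℂ] K))))
    (ζ η : lp (fun _ : ι => K) 2) (h : ∀ x ∈ A, ∑' i, inner ℂ (ζ i) (x (η i)) = 0) :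
    ∑' i, inner ℂ (ζ i) (T (η i)) = 0 := by
  classical
  let W := (amplifiedOrbit A η).topologicalClosure
  have hWclosed : IsClosed (W : Set (lp (fun _ : ι => K) 2)) :=
    Submodule.isClosed_topologicalClosure _
  have : CompleteSpace W := hWclosed.completeSpace_coe
  let P := W.starProjection
  have hmem : ∀ x ∈ A, amplify ι x η ∈ W := fun x hx =>
    Submodule.le_topologicalClosure _ ⟨x, hx, rfl⟩
  have hinv : ∀ x ∈ A, ∀ v ∈ W, amplify ι x v ∈ W := by
    intro x hx v hv
    refine map_mem_closure (amplify ι x).continuous hv ?_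
    rintro _ ⟨y, hy, rfl⟩
    exact ⟨x * y, mul_mem hx hy, lp.ext (funext fun i => by simp)⟩
  -- As `A` is closed under adjoints, `Wᗮ` is invariant as well.
  have hcomm : ∀ x ∈ A, ∀ v, P (amplify ι x v) = amplify ι x (P v) := by
    intro x hx v
    refine Submodule.eq_starProjection_of_mem_of_inner_eq_zero
      (hinv x hx _ (W.starProjection_apply_mem v)) fun w hw => ?_
    rw [← map_sub, inner_amplify_left]
    exact W.starProjection_inner_eq_zero v _ (hinv _ (star_mem hx) w hw)
  have hsingle : ∀ (x : K →L[ℂ] K) (j : ι) (a : K),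
      amplify ι x (lp.single 2 j a) = lp.single 2 j (x a) := fun x j a =>
    lp.ext (funext fun i => by
      rw [amplify_apply, lp.single_apply, lp.single_apply]
      rcases eq_or_ne i j with rfl | hij
      · simp
      · simp [hij])
  -- The matrix entries of `P` lie in the commutant of `A`, so `T` commutes with each of them and
  -- its amplification commutes with `P`.
  let Q : ι → ι → K →L[ℂ] K := fun i j =>
    (lp.evalCLM ℂ (fun _ : ι => K) 2 i) ∘L P ∘L
      (lp.singleContinuousLinearMap ℂ (fun _ : ι => K) 2 j)
  have hQ : ∀ i j a, Q i j a = P (lp.single 2 j a) i := fun i j a => rfl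
  have hQmem : ∀ i j, Q i j ∈ Set.centralizer (A : Set (K →L[ℂ] K)) := by
    intro i j x hx
    ext a
    simp only [mul_apply_eq_comp, hQ, ← hsingle, hcomm x hx, amplify_apply]
  have hTP : (amplify ι T) ∘L P = P ∘L (amplify ι T) := by
    refine lp.ext_continuousLinearMap (by simp) fun j => ?_
    ext a i
    have := congrArg (fun S : K →L[ℂ] K => S a) (hT _ (hQmem i j))
    simpa [hQ, hsingle] using this.symm
  -- Unitality of `A` puts `η` in `W`; the amplified `T` then keeps it there, while the hypothesis
  -- makes `ζ` orthogonal to `W`.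
  have hη : P η = η := by
    refine Submodule.starProjection_eq_self_iff.2 ?_
    convert hmem 1 (one_mem A)
    exact lp.ext (funext fun i => by simp)
  have hTη : amplify ι T η ∈ W := by
    rw [← hη]
    have := congrArg (fun S : lp (fun _ : ι => K) 2 →L[ℂ] lp (fun _ : ι => K) 2 => S η) hTP
    simp only [ContinuousLinearMap.comp_apply] at this
    rw [this]
    exact W.starProjection_apply_mem _
  have hζ : W ≤ (ℂ ∙ ζ)ᗮ := by
    refine Submodule.topologicalClosure_minimal _ ?_ (Submodule.isClosed_orthogonal _)
    rintro _ ⟨x, hx, rfl⟩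
    rw [Submodule.mem_orthogonal_singleton_iff_inner_right, lp.inner_eq_tsum]
    exact h x hx
  have := Submodule.mem_orthogonal_singleton_iff_inner_right.1 (hζ hTη)
  rwa [lp.inner_eq_tsum] at this

end Amplification

/-! ### The von Neumann algebra of bounded orbits -/

section OrbitAlgebra

variable {H : Type u} [NormedAddCommGroup H] [InnerProductSpace ℂ H] [CompleteSpace H]
variable {M : VonNeumannAlgebra H}

/-- `T` is the diagonal operator on `ℓ²(ℤ, H)` with entries `c n`. -/
def IsDiagonal (T : lp (fun _ : ℤ => H) 2 →L[ℂ] lp (fun _ : ℤ => H) 2)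
    (c : ℤ → M.toStarSubalgebra) : Prop :=
  ∀ v n, T v n = (c n : H →L[ℂ] H) (v n)

variable {T S : lp (fun _ : ℤ => H) 2 →L[ℂ] lp (fun _ : ℤ => H) 2}
  {c d : ℤ → M.toStarSubalgebra}

lemma IsDiagonal.single (h : IsDiagonal T c) (n : ℤ) (a : H) :
    T (lp.single 2 n a) = lp.single 2 n ((c n : H →L[ℂ] H) a) := by
  refine lp.ext (funext fun i => ?_)
  rw [h, lp.single_apply, lp.single_apply]
  rcases eq_or_ne i n with rfl | hin
  · simp
  · simp [hin]

lemma IsDiagonal.unique (h : IsDiagonal T c) (h' : IsDiagonal T d) : c = d := by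
  refine funext fun n => Subtype.ext (ContinuousLinearMap.ext fun a => ?_)
  simpa using (h (lp.single 2 n a) n).symm.trans (h' (lp.single 2 n a) n)

lemma IsDiagonal.ext (h : IsDiagonal T c) (h' : IsDiagonal S c) : T = S :=
  ContinuousLinearMap.ext fun v => lp.ext (funext fun n => (h v n).trans (h' v n).symm)

lemma IsDiagonal.add (h : IsDiagonal T c) (h' : IsDiagonal S d) :
    IsDiagonal (T + S) fun n => c n + d n := fun v n => by
  simp [h v n, h' v n]

lemma IsDiagonal.mul (h : IsDiagonal T c) (h' : IsDiagonal S d) :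
    IsDiagonal (T * S) fun n => c n * d n := fun v n => by
  simp [h (S v) n, h' v n]

lemma isDiagonal_algebraMap (r : ℂ) :
    IsDiagonal (algebraMap ℂ (lp (fun _ : ℤ => H) 2 →L[ℂ] lp (fun _ : ℤ => H) 2) r)
      fun _ => algebraMap ℂ M.toStarSubalgebra r := fun v n => by
  simp [Algebra.algebraMap_eq_smul_one]

lemma IsDiagonal.star (h : IsDiagonal T c) : IsDiagonal (star T) fun n => star (c n) :=
  fun v n => by
    refine ext_inner_left ℂ fun a : H => ?_
    have h1 := lp.inner_single_left (𝕜 := ℂ) n a (ContinuousLinearMap.adjoint T v)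
    rw [ContinuousLinearMap.adjoint_inner_right, h.single, lp.inner_single_left] at h1
    exact h1.symm.trans (ContinuousLinearMap.adjoint_inner_right _ _ _).symm

lemma IsDiagonal.norm_le (h : IsDiagonal T c) (n : ℤ) : ‖c n‖ ≤ ‖T‖ := by
  refine ContinuousLinearMap.opNorm_le_bound _ (norm_nonneg _) fun a => ?_
  have h1 := T.le_opNorm (lp.single 2 n a)
  rwa [h.single, lp.norm_single (by norm_num), lp.norm_single (by norm_num)] at h1

/-- The algebra of diagonal operators on `ℓ²(ℤ, H)` whose entries form an orbit of `α`. -/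
noncomputable def orbitAlgebra (α : M.toStarSubalgebra →⋆ₐ[ℂ] M.toStarSubalgebra) :
    StarSubalgebra ℂ (lp (fun _ : ℤ => H) 2 →L[ℂ] lp (fun _ : ℤ => H) 2) where
  carrier := {T | ∃ c : ℤ → M.toStarSubalgebra, (∀ n, c (n + 1) = α (c n)) ∧ IsDiagonal T c}
  mul_mem' := by
    rintro T S ⟨c, hc, hT⟩ ⟨d, hd, hS⟩
    exact ⟨_, fun n => by rw [hc, hd, map_mul], hT.mul hS⟩
  add_mem' := by
    rintro T S ⟨c, hc, hT⟩ ⟨d, hd, hS⟩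
    exact ⟨_, fun n => by rw [hc, hd, map_add], hT.add hS⟩
  algebraMap_mem' r := ⟨_, fun _ => (AlgHomClass.commutes α r).symm, isDiagonal_algebraMap r⟩
  star_mem' := by
    rintro T ⟨c, hc, hT⟩
    exact ⟨_, fun n => by rw [hc, map_star], hT.star⟩

lemma mem_orbitAlgebra {α : M.toStarSubalgebra →⋆ₐ[ℂ] M.toStarSubalgebra} :
    T ∈ orbitAlgebra α ↔
      ∃ c : ℤ → M.toStarSubalgebra, (∀ n, c (n + 1) = α (c n)) ∧ IsDiagonal T c := Iff.rfl

/-- These blocks are the test elements for the bicommutant: `s = 1` forces diagonality, and general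
`s` forces the entries into `M'' = M`. -/
lemma atCoord_mem_centralizer (α : M.toStarSubalgebra →⋆ₐ[ℂ] M.toStarSubalgebra) (n : ℤ)
    {s : H →L[ℂ] H} (hs : s ∈ M.commutant) :
    atCoord n s ∈ Set.centralizer
      (orbitAlgebra α : Set (lp (fun _ : ℤ => H) 2 →L[ℂ] lp (fun _ : ℤ => H) 2)) := by
  rintro T ⟨c, -, hT⟩
  ext1 v
  rw [mul_apply_eq_comp, mul_apply_eq_comp, atCoord_apply, atCoord_apply,
    hT.single, hT v n]
  exact congrArg _ (congrArg (fun S : H →L[ℂ] H => S (v n))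
    (VonNeumannAlgebra.mem_commutant_iff.1 hs _ (c n).2))

/-- Operators in the bicommutant of the orbit algebra are diagonal with entries in `M`. -/
lemma exists_isDiagonal_of_mem_bicommutant (α : M.toStarSubalgebra →⋆ₐ[ℂ] M.toStarSubalgebra)
    (hT : T ∈ Set.centralizer (Set.centralizer
      (orbitAlgebra α : Set (lp (fun _ : ℤ => H) 2 →L[ℂ] lp (fun _ : ℤ => H) 2)))) :
    ∃ c : ℤ → M.toStarSubalgebra, IsDiagonal T c := by
  let c : ℤ → H →L[ℂ] H := fun n => (lp.evalCLM ℂ (fun _ : ℤ => H) 2 n) ∘L T ∘L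
    (lp.singleContinuousLinearMap ℂ (fun _ : ℤ => H) 2 n)
  have hc : ∀ n a, c n a = T (lp.single 2 n a) n := fun n a => rfl
  have hcomm : ∀ n, ∀ s ∈ M.commutant, ∀ v, lp.single 2 n (s (T v n)) =
      T (lp.single 2 n (s (v n))) := fun n s hs v =>
    congrArg (fun S : lp (fun _ : ℤ => H) 2 →L[ℂ] lp (fun _ : ℤ => H) 2 => S v)
      (hT _ (atCoord_mem_centralizer α n hs))
  refine ⟨fun n => ⟨c n, ?_⟩, fun v n => ?_⟩
  · change c n ∈ M
    rw [← M.commutant_commutant, VonNeumannAlgebra.mem_commutant_iff]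
    intro s hs
    ext a
    have h1 := congrArg (fun w : lp (fun _ : ℤ => H) 2 => w n) (hcomm n s hs (lp.single 2 n a))
    simpa [hc] using h1
  · have h1 := congrArg (fun w : lp (fun _ : ℤ => H) 2 => w n) (hcomm n 1 (one_mem _) v)
    simpa [hc] using h1

/-- Normality of `α` makes each matrix coefficient of `α (c n) - c (n + 1)` an ultraweakly
continuous functional of `T`. It vanishes on the orbit algebra, hence on its bicommutant. -/
lemma orbit_of_mem_bicommutant {α : M.toStarSubalgebra →⋆ₐ[ℂ] M.toStarSubalgebra}
    (hα : IsNormalHom α)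
    (hT : T ∈ Set.centralizer (Set.centralizer
      (orbitAlgebra α : Set (lp (fun _ : ℤ => H) 2 →L[ℂ] lp (fun _ : ℤ => H) 2))))
    (hc : IsDiagonal T c) (n : ℤ) : c (n + 1) = α (c n) := by
  refine Subtype.ext (ContinuousLinearMap.ext fun η => ext_inner_left ℂ fun ξ => ?_)
  obtain ⟨ρ, hρ, hρe⟩ := isNormalFunctional_inner M ξ η
  obtain ⟨ξ', η', hξ', hη', hs⟩ := hα ρ hρ
  -- Index `0` carries the term for `-c (n + 1)`, and the later indices carry the series for `ρ ∘ α`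
  -- at coordinate `n`.
  let f : ℕ → lp (fun _ : ℤ => H) 2 := fun k =>
    Nat.casesOn k (lp.single 2 (n + 1) ξ) fun k => lp.single 2 n (ξ' k)
  let g : ℕ → lp (fun _ : ℤ => H) 2 := fun k =>
    Nat.casesOn k (-lp.single 2 (n + 1) η) fun k => lp.single 2 n (η' k)
  have hf : Memℓp f 2 := by
    refine memℓp_gen ((summable_nat_add_iff 1).1 ?_)
    simpa [f, lp.norm_single] using hξ'
  have hg : Memℓp g 2 := by
    refine memℓp_gen ((summable_nat_add_iff 1).1 ?_)
    simpa [g, lp.norm_single] using hη'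
  have key : ∀ (S : lp (fun _ : ℤ => H) 2 →L[ℂ] lp (fun _ : ℤ => H) 2)
      (d : ℤ → M.toStarSubalgebra), IsDiagonal S d →
      ∑' k, inner ℂ (f k) (S (g k)) = inner ℂ ξ ((α (d n) : H →L[ℂ] H) η) -
        inner ℂ ξ ((d (n + 1) : H →L[ℂ] H) η) := by
    intro S d hd
    let F : ℕ → ℂ := fun k => inner ℂ (f k) (S (g k))
    have hF0 : F 0 = -inner ℂ ξ ((d (n + 1) : H →L[ℂ] H) η) := by
      change inner ℂ (lp.single 2 (n + 1) ξ) (S (-lp.single 2 (n + 1) η)) = _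
      rw [map_neg, inner_neg_right, hd.single, lp.inner_single_left, lp.single_apply_self]
    have hF : HasSum (fun k => F (k + 1)) (inner ℂ ξ ((α (d n) : H →L[ℂ] H) η)) := by
      have hF1 : (fun k => F (k + 1)) =
          fun k => inner ℂ (ξ' k) ((d n : H →L[ℂ] H) (η' k)) := by
        ext k
        change inner ℂ (lp.single 2 n (ξ' k)) (S (lp.single 2 n (η' k))) = _
        rw [hd.single, lp.inner_single_left, lp.single_apply_self]
      rw [hF1, ← hρe]
      exact hs (d n)
    have h2 : HasSum F (F 0 + _) := HasSum.zero_add hF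
    change ∑' k, F k = _
    rw [h2.tsum_eq, hF0, neg_add_eq_sub]
  have h0 := (orbitAlgebra α).tsum_inner_eq_zero_of_mem_bicommutant hT
    (⟨f, hf⟩ : lp (fun _ : ℕ => lp (fun _ : ℤ => H) 2) 2) ⟨g, hg⟩ (by
      rintro S ⟨d, hd, hS⟩
      exact (key S d hS).trans (by rw [hd, sub_self]))
  exact (sub_eq_zero.1 ((key T c hc).symm.trans h0)).symm

/-- The orbit algebra of a normal endomorphism is a von Neumann algebra. -/
noncomputable def orbitVonNeumannAlgebra {α : M.toStarSubalgebra →⋆ₐ[ℂ] M.toStarSubalgebra}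
    (hα : IsNormalHom α) : VonNeumannAlgebra (lp (fun _ : ℤ => H) 2) where
  toStarSubalgebra := orbitAlgebra α
  centralizer_centralizer' := by
    refine Set.Subset.antisymm (fun T hT => ?_) Set.subset_centralizer_centralizer
    obtain ⟨c, hc⟩ := exists_isDiagonal_of_mem_bicommutant α hT
    exact ⟨c, orbit_of_mem_bicommutant hα hT hc, hc⟩

end OrbitAlgebra

/-! ### The shift on orbits as an asymptotic lifting -/

section OrbitLifting

variable {H : Type u} [NormedAddCommGroup H] [InnerProductSpace ℂ H] [CompleteSpace H]
variable {M : VonNeumannAlgebra H} {α : M.toStarSubalgebra →⋆ₐ[ℂ] M.toStarSubalgebra}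

namespace orbitAlgebra

/-- The orbit of diagonal entries of an element of the orbit algebra. -/
noncomputable def entries (T : orbitAlgebra α) : ℤ → M.toStarSubalgebra :=
  (mem_orbitAlgebra.1 T.2).choose

lemma isDiagonal_entries (T : orbitAlgebra α) :
    IsDiagonal (T : lp (fun _ : ℤ => H) 2 →L[ℂ] lp (fun _ : ℤ => H) 2) (entries T) :=
  (mem_orbitAlgebra.1 T.2).choose_spec.2

lemma entries_eq {T : orbitAlgebra α} {c : ℤ → M.toStarSubalgebra}
    (h : IsDiagonal (T : lp (fun _ : ℤ => H) 2 →L[ℂ] lp (fun _ : ℤ => H) 2) c) :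
    entries T = c :=
  (isDiagonal_entries T).unique h

lemma isBoundedOrbit_entries (T : orbitAlgebra α) : IsBoundedOrbit α (entries T) where
  map := (mem_orbitAlgebra.1 T.2).choose_spec.1
  bounded := ⟨_, norm_nonneg _, (isDiagonal_entries T).norm_le⟩

lemma entries_injective : Function.Injective (entries (α := α)) := fun T S h =>
  Subtype.ext ((isDiagonal_entries T).ext (h ▸ isDiagonal_entries S))

lemma exists_entries_eq {c : ℤ → M.toStarSubalgebra} (hc : IsBoundedOrbit α c) :
    ∃ T : orbitAlgebra α, entries T = c := by
  obtain ⟨C, hC, hcC⟩ := hc.bounded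
  exact ⟨⟨lp.mapCLM 2 (fun n => (c n : H →L[ℂ] H)) hC hcC, c, hc.map, fun _ _ => rfl⟩,
    entries_eq fun _ _ => rfl⟩

/-- The homomorphism taking an element of the orbit algebra to its `n`-th diagonal entry. -/
noncomputable def entryHom (α : M.toStarSubalgebra →⋆ₐ[ℂ] M.toStarSubalgebra) (n : ℤ) :
    orbitAlgebra α →⋆ₐ[ℂ] M.toStarSubalgebra where
  toFun T := entries T n
  map_one' := congrFun (entries_eq (c := fun _ => 1) fun _ _ => rfl) n
  map_mul' T S := congrFun (entries_eq (T := T * S)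
    ((isDiagonal_entries T).mul (isDiagonal_entries S))) n
  map_zero' := congrFun (entries_eq (c := fun _ => 0) fun _ _ => rfl) n
  map_add' T S := congrFun (entries_eq (T := T + S)
    ((isDiagonal_entries T).add (isDiagonal_entries S))) n
  commutes' r := congrFun (entries_eq (α := α) (T := algebraMap ℂ _ r)
    (c := fun _ => algebraMap ℂ _ r) (isDiagonal_algebraMap r)) n
  map_star' T := congrFun (entries_eq (T := star T) (isDiagonal_entries T).star) n

lemma entryHom_ext {T S : orbitAlgebra α} (h : ∀ n, entryHom α n T = entryHom α n S) : T = S :=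
  entries_injective (funext h)

/-- The shift by `k`, as a map on the orbit algebra. -/
noncomputable def shiftFun (k : ℤ) (T : orbitAlgebra α) : orbitAlgebra α :=
  (exists_entries_eq ((isBoundedOrbit_entries T).shift k)).choose

lemma entryHom_shiftFun (k n : ℤ) (T : orbitAlgebra α) :
    entryHom α n (shiftFun k T) = entryHom α (n + k) T :=
  congrFun (exists_entries_eq ((isBoundedOrbit_entries T).shift k)).choose_spec n

/-- The bilateral shift automorphism of the orbit algebra. -/
noncomputable def shift (α : M.toStarSubalgebra →⋆ₐ[ℂ] M.toStarSubalgebra) :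
    orbitAlgebra α ≃⋆ₐ[ℂ] orbitAlgebra α where
  toFun := shiftFun 1
  invFun := shiftFun (-1)
  left_inv T := entryHom_ext fun n => by simp [entryHom_shiftFun]
  right_inv T := entryHom_ext fun n => by simp [entryHom_shiftFun]
  map_mul' T S := entryHom_ext fun n => by simp only [entryHom_shiftFun, map_mul]
  map_add' T S := entryHom_ext fun n => by simp only [entryHom_shiftFun, map_add]
  map_star' T := entryHom_ext fun n => by simp only [entryHom_shiftFun, map_star]
  map_smul' r T := entryHom_ext fun n => by simp only [entryHom_shiftFun, map_smul]

lemma entryHom_shift (n : ℤ) (T : orbitAlgebra α) :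
    entryHom α n (shift α T) = entryHom α (n + 1) T :=
  entryHom_shiftFun 1 n T

lemma entryHom_shift_zpow (k n : ℤ) (T : orbitAlgebra α) :
    entryHom α n ((shift α ^ k) T) = entryHom α (n + k) T :=
  (shift α).apply_zpow_of_apply_eq (fun n => entryHom α n) (fun n => entryHom_shift n) k n T

end orbitAlgebra

open orbitAlgebra

/-- Placing the vectors that represent `ρ` in coordinate `n` represents its pullback. -/
lemma isNormalHom_entryHom (hα : IsNormalHom α) (n : ℤ) :
    IsNormalHom (N := orbitVonNeumannAlgebra hα) (entryHom α n) := by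
  rintro ρ ⟨ξ, η, hξ, hη, hρ⟩
  refine ⟨fun k => lp.single 2 n (ξ k), fun k => lp.single 2 n (η k), ?_, ?_, fun T => ?_⟩
  · simpa [lp.norm_single] using hξ
  · simpa [lp.norm_single] using hη
  · convert hρ (entryHom α n T) using 2 with k
    swap
    · rfl
    rw [(isDiagonal_entries (α := α) T).single, lp.inner_single_left, lp.single_apply_self]
    rfl

/-- The orbit algebra with the bilateral shift is an asymptotic lifting. -/
theorem isAsymptoticLifting_shift (hα : IsNormalHom α) :
    IsAsymptoticLifting (N := orbitVonNeumannAlgebra hα) α (shift α) (entryHom α 0) where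
  normal := isNormalHom_entryHom hα 0
  intertwines T := (entryHom_shift 0 T).trans ((isBoundedOrbit_entries (α := α) T).map 0)
  nondegenerate T hT := by
    refine entryHom_ext (α := α) (S := 0) fun n => ?_
    have h := entryHom_shift_zpow n 0 (α := α) T
    rw [zero_add] at h
    rw [map_zero, ← h]
    exact hT n
  range_eq := by
    refine Set.Subset.antisymm ?_ fun x hx => ?_
    · rintro _ ⟨T, rfl⟩
      exact (isBoundedOrbit_entries (α := α) T).mem_tailAlgebra 0
    · obtain ⟨c, hc, rfl⟩ := exists_isBoundedOrbit hα hx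
      obtain ⟨T, hT⟩ := exists_entries_eq hc
      exact ⟨T, congrFun hT 0⟩

end OrbitLifting

theorem theorem2p5 {H : Type u} [NormedAddCommGroup H] [InnerProductSpace ℂ H] [CompleteSpace H]
    (M : VonNeumannAlgebra H) (α : M.toStarSubalgebra →⋆ₐ[ℂ] M.toStarSubalgebra)
    (hα : IsNormalHom α) :
    (∃ (K : Type u) (_ : NormedAddCommGroup K) (_ : InnerProductSpace ℂ K) (_ : CompleteSpace K)
      (N : VonNeumannAlgebra K) (β : N.toStarSubalgebra ≃⋆ₐ[ℂ] N.toStarSubalgebra)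
      (E : N.toStarSubalgebra →⋆ₐ[ℂ] M.toStarSubalgebra), IsAsymptoticLifting α β E) ∧
    (∀ (K₁ : Type v) [NormedAddCommGroup K₁] [InnerProductSpace ℂ K₁] [CompleteSpace K₁]
      (K₂ : Type w) [NormedAddCommGroup K₂] [InnerProductSpace ℂ K₂] [CompleteSpace K₂]
      (N₁ : VonNeumannAlgebra K₁) (N₂ : VonNeumannAlgebra K₂)
      (β₁ : N₁.toStarSubalgebra ≃⋆ₐ[ℂ] N₁.toStarSubalgebra)
      (E₁ : N₁.toStarSubalgebra →⋆ₐ[ℂ] M.toStarSubalgebra)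
      (β₂ : N₂.toStarSubalgebra ≃⋆ₐ[ℂ] N₂.toStarSubalgebra)
      (E₂ : N₂.toStarSubalgebra →⋆ₐ[ℂ] M.toStarSubalgebra),
      IsAsymptoticLifting α β₁ E₁ → IsAsymptoticLifting α β₂ E₂ →
        LiftingsIsomorphic β₁ E₁ β₂ E₂) := by
  refine ⟨⟨lp (fun _ : ℤ => H) 2, inferInstance, inferInstance, inferInstance,
    orbitVonNeumannAlgebra hα, orbitAlgebra.shift α, orbitAlgebra.entryHom α 0,
    isAsymptoticLifting_shift hα⟩, ?_⟩
  intro K₁ _ _ _ K₂ _ _ _ N₁ N₂ β₁ E₁ β₂ E₂ h₁ h₂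
  exact h₁.liftingsIsomorphic h₂
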